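/- Let $n\ge 3$ and let $P_1,\dots,P_n$ be the vertices, in cyclic order, of a convex polygon in $\mathbb{R}^2$ (so that, for each edge, the remaining vertices lie strictly on one side of the line through that edge). Let $G$ be the open region enclosed by the polygon, and let $\alpha\in(0,\pi)$ be the smallest of its inner angles. Then \[ A_G \;\ge\; 1+\frac{1}{\sin(\alpha/2)} . \] Here $A_G$ is the uniformity constant of $G$, \[ A_G=\inf\{A\ge 1 : k_G(x,y)\le A\, j_G(x,y)\ \text{ for all } x,y\in G\}\qquad(\inf\emptyset=+\infty), \] where, with $d_G(z)=\operatorname{dist}(z,\partial G)$, \[ k_G(x,y)=\inf_\gamma\int_\gamma\frac{|dz|}{d_G(z)},\qquad j_G(x,y)=\log\Bigl(1+\frac{|x-y|}{\min\{d_G(x),d_G(y)\}}\Bigr), \] and the infimum in $k_G$ is taken over all rectifiable curves $\gamma$ joining $x$ and $y$ in $G$. -/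

import Mathlib

open Set MeasureTheory
open scoped ENNReal EuclideanGeometry unitInterval

noncomputable section

/-- The quasihyperbolic length `∫_γ |dz| / d(z, ∂G)` of a rectifiable curve `γ` in a domain `G`:
the line integral with respect to arc length, computed in the arc-length parametrization
`s ↦ naturalParameterization γ univ 0 s`, `0 ≤ s ≤ L`, where `L` is the length of `γ`. -/
def qhLength {E : Type*} [MetricSpace E] (G : Set E) {x y : E} (γ : Path x y) : ℝ≥0∞ :=
  ∫⁻ s in Icc (0 : ℝ) (eVariationOn γ univ).toReal,
    (ENNReal.ofReal (Metric.infDist (naturalParameterization γ univ (0 : I) s) (frontier G)))⁻¹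

/-- The quasihyperbolic distance `k_G(x, y)`: the infimum of the quasihyperbolic lengths of the
rectifiable curves that join `x` and `y` in `G`. -/
def qhDist {E : Type*} [MetricSpace E] (G : Set E) (x y : E) : ℝ≥0∞ :=
  ⨅ (γ : Path x y) (_ : BoundedVariationOn γ univ) (_ : ∀ t, γ t ∈ G), qhLength G γ

/-- The distance ratio metric `j_G(x, y) = log (1 + |x - y| / min {d_G(x), d_G(y)})`. -/
def distRatio {E : Type*} [MetricSpace E] (G : Set E) (x y : E) : ℝ :=
  Real.log (1 + dist x y / min (Metric.infDist x (frontier G)) (Metric.infDist y (frontier G)))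

/-- The uniformity constant `A_G = inf {A ≥ 1 : k_G ≤ A j_G on G × G}`, as an extended real number:
it is `⊤` if there is no such real number `A`, that is, if `G` is not uniform. -/
def uniformityConst {E : Type*} [MetricSpace E] (G : Set E) : EReal :=
  ⨅ (A : ℝ) (_ : 1 ≤ A ∧ ∀ x ∈ G, ∀ y ∈ G, qhDist G x y ≤ ENNReal.ofReal (A * distRatio G x y)),
    (A : EReal)

namespace Polygon

/-- A polygon in the plane with vertices `P 0, …, P (n - 1)` in cyclic order is convex if `3 ≤ n`
and, for each edge, the vertices not on this edge lie strictly on one side of the line through the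
edge. (All inner angles are then less than `π`.) -/
def IsConvex {n : ℕ} [NeZero n] (P : Polygon (EuclideanSpace ℝ (Fin 2)) n) : Prop :=
  3 ≤ n ∧ ∀ i j k : Fin n, j ≠ i → j ≠ i + 1 → k ≠ i → k ≠ i + 1 →
    line[ℝ, P i, P (i + 1)].SSameSide (P j) (P k)

/-- The inner angle of a convex polygon at the vertex `P i`, with values in `[0, π]`. -/
def innerAngle {n : ℕ} [NeZero n] (P : Polygon (EuclideanSpace ℝ (Fin 2)) n) (i : Fin n) : ℝ :=
  ∠ (P (i - 1)) (P i) (P (i + 1))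

/-- The open region of the plane enclosed by a convex polygon. -/
def convexRegion {n : ℕ} (P : Polygon (EuclideanSpace ℝ (Fin 2)) n) :
    Set (EuclideanSpace ℝ (Fin 2)) :=
  interior (convexHull ℝ (range P.vertices))

end Polygon

end

/-!
The constant `1 + 1 / sin (α / 2)` is forced by pairs of points that approach two different
vertices. Let `G` be the region, `α` its inner angle at the vertex `V`, and let `W` be the next
vertex. Averaging the inner unit normals of the two edges at `V` gives
`d_G(z) ≤ sin (α / 2) * |z - V|` on `G`, since the sum of these normals has norm `2 sin (α / 2)`;
trivially `d_G(z) ≤ |z - W|`, as `W` is a boundary point. Take `x` and `y` at distance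
at most `r` from `V` and `W`, and a curve of length `L` from `x` to `y`, parametrized by arc length.
Then `d_G(γ(s)) ≤ sin (α / 2) * (r + s)` and `d_G(γ(s)) ≤ r + (L - s)`. Using the first bound on the
first half of the curve and the second bound on the second half, one obtains
`k_G(x, y) ≥ (1 + 1 / sin (α / 2)) * log (1 + |x - y| / (2 r))`; this is `ofReal_le_qhDist`.

If `x` and `y` are the images of `V` and `W` under the contraction with ratio `1 - t` towards an
interior point of `G`, then convexity keeps them at distance at least a multiple of `t` from the
boundary, while `r` is of order `t`. So `j_G(x, y)` is at most `log (1 / t) + O(1)` and `k_G(x, y)`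
at least `(1 + 1 / sin (α / 2)) * log (1 / t) - O(1)`, and `t → 0` gives the claim
(`Convex.one_add_inv_le_of_qhDist_le`). The bound holds at every vertex, hence also at one where
the angle is smallest.
-/

open Filter Topology
open scoped RealInnerProductSpace

/-! ### Arc-length parametrization -/

theorem BoundedVariationOn.continuous_variationOnFromTo {α E : Type*} [LinearOrder α]
    [TopologicalSpace α] [OrderTopology α] [PseudoMetricSpace E] {f : α → E}
    (hf : BoundedVariationOn f univ) (hc : Continuous f) (a : α) :
    Continuous (variationOnFromTo f univ a) := by
  refine continuous_iff_continuousAt.2 fun x => tendsto_iff_dist_tendsto_zero.2 ?_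
  have hl := (ENNReal.tendsto_toReal ENNReal.zero_ne_top).comp
    (hf.tendsto_eVariationOn_Icc_zero_left (x := x) hc.continuousWithinAt)
  have hr := (ENNReal.tendsto_toReal ENNReal.zero_ne_top).comp
    (hf.tendsto_eVariationOn_Icc_zero_right x hc.continuousWithinAt)
  have h := hl.add hr
  simp only [nhdsWithin_univ, ENNReal.toReal_zero, add_zero] at h
  refine squeeze_zero (fun _ => dist_nonneg) (fun y => ?_) h
  rw [Real.dist_eq, variationOnFromTo.sub_right hf.locallyBoundedVariationOn (mem_univ _)
    (mem_univ _) (mem_univ _), variationOnFromTo]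
  split_ifs
  · rw [abs_of_nonneg ENNReal.toReal_nonneg]
    exact le_add_of_nonneg_left ENNReal.toReal_nonneg
  · rw [abs_neg, abs_of_nonneg ENNReal.toReal_nonneg]
    exact le_add_of_nonneg_right ENNReal.toReal_nonneg

/-- `naturalParameterization` takes a junk value at any real outside the range of the arc-length
function. For a continuous curve this range is all of `[0, L]`, `L` the length, so every value on
`[0, L]` is a point of the curve, and the arcs before and after it have lengths `s` and `L - s`. -/
theorem Path.exists_naturalParameterization_eq {E : Type*} [MetricSpace E] {x y : E}
    (γ : Path x y) (hγ : BoundedVariationOn γ univ) {s : ℝ}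
    (hs : s ∈ Icc 0 (eVariationOn γ univ).toReal) :
    ∃ t : I, naturalParameterization γ univ (0 : I) s = γ t ∧ dist (γ t) x ≤ s ∧
      dist (γ t) y ≤ (eVariationOn γ univ).toReal - s := by
  have h0 : variationOnFromTo γ univ (0 : I) 0 = 0 := variationOnFromTo.self _ _ _
  have h1 : variationOnFromTo γ univ (0 : I) 1 = (eVariationOn γ univ).toReal := by
    rw [variationOnFromTo.eq_of_le _ _ zero_le_one]
    congr 2
    ext t
    simp [unitInterval.le_one']
  obtain ⟨t, rfl⟩ := intermediate_value_univ (0 : I) 1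
    (hγ.continuous_variationOnFromTo γ.continuous 0) (by rwa [h0, h1])
  have hle {a b : I} (hab : a ≤ b) : dist (γ a) (γ b) ≤ variationOnFromTo γ univ a b := by
    rw [variationOnFromTo.eq_of_le _ _ hab]
    exact BoundedVariationOn.dist_le (hγ.mono inter_subset_left)
      ⟨mem_univ _, left_mem_Icc.2 hab⟩ ⟨mem_univ _, right_mem_Icc.2 hab⟩
  refine ⟨t, edist_eq_zero.1 (edist_naturalParameterization_eq_zero
    hγ.locallyBoundedVariationOn (mem_univ _) (mem_univ t)), ?_, ?_⟩
  · simpa [dist_comm] using hle (a := 0) (b := t) t.2.1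
  · rw [← h1, variationOnFromTo.sub_right hγ.locallyBoundedVariationOn (mem_univ _)
      (mem_univ _) (mem_univ _)]
    simpa using hle (a := t) (b := 1) t.2.2

theorem ofReal_log_le_lintegral {κ r l : ℝ} (hκ : 0 < κ) (hr : 0 < r) (hl : 0 ≤ l) :
    ENNReal.ofReal (1 / κ * Real.log (1 + l / r)) ≤
      ∫⁻ s in Ioo 0 l, (ENNReal.ofReal (κ * (r + s)))⁻¹ := by
  rw [setLIntegral_congr Ioo_ae_eq_Ioc]
  have hpos : ∀ s ∈ Icc 0 l, 0 < r + s := fun s hs => add_pos_of_pos_of_nonneg hr hs.1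
  have hcont : ContinuousOn (fun s => (κ * (r + s))⁻¹) (Icc 0 l) :=
    ContinuousOn.inv₀ (by fun_prop) fun s hs => (mul_pos hκ (hpos s hs)).ne'
  have hint : ∫ s in Ioc 0 l, (κ * (r + s))⁻¹ = 1 / κ * Real.log (1 + l / r) := by
    rw [← intervalIntegral.integral_of_le hl]
    simp only [mul_inv]
    rw [intervalIntegral.integral_const_mul,
      intervalIntegral.integral_comp_add_left (fun s => s⁻¹) r,
      integral_inv_of_pos (by linarith) (by linarith)]
    congr 2 <;> field_simp
    ring
  rw [← hint, ofReal_integral_eq_lintegral_ofReal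
    ((hcont.integrableOn_Icc).mono_set Ioc_subset_Icc_self)]
  · refine (setLIntegral_congr_fun measurableSet_Ioc fun s hs => ?_).le
    exact ENNReal.ofReal_inv_of_pos (mul_pos hκ (hpos s (Ioc_subset_Icc_self hs)))
  · filter_upwards [ae_restrict_mem measurableSet_Ioc] with s hs
    exact (inv_pos.2 (mul_pos hκ (hpos s (Ioc_subset_Icc_self hs)))).le

/-- The term `1 / κ` is the contribution of the first half of a curve from `x` to `y`, where
`d_G ≤ κ * (r + s)` at arc length `s` from `x`, and the term `1` that of the second half, where
`d_G ≤ r + s` at arc length `s` from `y`. -/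
theorem ofReal_le_qhDist {E : Type*} [MetricSpace E] {G : Set E} {V W x y : E} {κ r : ℝ}
    (hκ : 0 < κ) (hr : 0 < r)
    (hV : ∀ z ∈ G, Metric.infDist z (frontier G) ≤ κ * dist z V)
    (hW : ∀ z ∈ G, Metric.infDist z (frontier G) ≤ dist z W)
    (hx : dist x V ≤ r) (hy : dist y W ≤ r) :
    ENNReal.ofReal ((1 + 1 / κ) * Real.log (1 + dist x y / 2 / r)) ≤ qhDist G x y := by
  refine le_iInf fun γ => le_iInf fun hγ => le_iInf fun hG => ?_
  set L := (eVariationOn γ univ).toReal with hL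
  have hxy : dist x y ≤ L := by
    simpa using BoundedVariationOn.dist_le hγ (mem_univ (0 : I)) (mem_univ (1 : I))
  have hL0 : 0 ≤ L := ENNReal.toReal_nonneg
  have hL2 : 0 ≤ L / 2 := by positivity
  have hlog : Real.log (1 + dist x y / 2 / r) ≤ Real.log (1 + L / 2 / r) := by
    gcongr
  have hlog0 : 0 ≤ Real.log (1 + L / 2 / r) :=
    Real.log_nonneg (le_add_of_nonneg_right (by positivity))
  have h1 : ENNReal.ofReal (1 / κ * Real.log (1 + L / 2 / r)) ≤
      ∫⁻ s in Ioo 0 (L / 2), (ENNReal.ofReal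
        (Metric.infDist (naturalParameterization γ univ (0 : I) s) (frontier G)))⁻¹ := by
    refine (ofReal_log_le_lintegral hκ hr hL2).trans ?_
    refine setLIntegral_mono' measurableSet_Ioo fun s hs => ?_
    obtain ⟨t, ht, htx, -⟩ := γ.exists_naturalParameterization_eq hγ (s := s)
      ⟨hs.1.le, by linarith [hs.2]⟩
    rw [ht, ENNReal.inv_le_inv]
    refine ENNReal.ofReal_le_ofReal ((hV _ (hG t)).trans ?_)
    have := dist_triangle (γ t) x V
    gcongr
    linarith
  have h2 : ENNReal.ofReal (Real.log (1 + L / 2 / r)) ≤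
      ∫⁻ s in Ioo (L / 2) L, (ENNReal.ofReal
        (Metric.infDist (naturalParameterization γ univ (0 : I) s) (frontier G)))⁻¹ := by
    -- The second half of the curve is traversed backwards, from `y`.
    have hpre : (fun s => L - s) ⁻¹' Ioo 0 (L / 2) = Ioo (L / 2) L := by
      rw [preimage_const_sub_Ioo, sub_zero, sub_half]
    have h := ofReal_log_le_lintegral one_pos hr hL2
    rw [← (Measure.measurePreserving_sub_left volume L).setLIntegral_comp_preimage_emb
      (MeasurableEquiv.subLeft L).measurableEmbedding, hpre, div_one, one_mul] at h
    refine h.trans (setLIntegral_mono' measurableSet_Ioo fun s hs => ?_)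
    obtain ⟨t, ht, -, hty⟩ := γ.exists_naturalParameterization_eq hγ (s := s)
      ⟨by linarith [hs.1], hs.2.le⟩
    rw [ht, ENNReal.inv_le_inv]
    refine ENNReal.ofReal_le_ofReal ((hW _ (hG t)).trans ?_)
    have := dist_triangle (γ t) y W
    linarith
  have hdisj : Disjoint (Ioo 0 (L / 2)) (Ioo (L / 2) L) :=
    Set.disjoint_left.2 fun s hs hs' => (hs.2.trans hs'.1).false
  calc _ ≤ ENNReal.ofReal (1 / κ * Real.log (1 + L / 2 / r) + Real.log (1 + L / 2 / r)) := by
        refine ENNReal.ofReal_le_ofReal ?_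
        rw [add_comm, ← add_one_mul, add_comm]
        gcongr
    _ ≤ _ := by
      rw [ENNReal.ofReal_add (by positivity) hlog0]
      refine (add_le_add h1 h2).trans ?_
      rw [← lintegral_union measurableSet_Ioo hdisj, qhLength]
      refine lintegral_mono_set (union_subset ?_ ?_)
      · exact fun s hs => ⟨hs.1.le, by linarith [hs.2]⟩
      · exact fun s hs => ⟨by linarith [hs.1], hs.2.le⟩

/-! ### Distance to the boundary -/

theorem infDist_frontier_le_dist {E : Type*} [NormedAddCommGroup E] [NormedSpace ℝ E]
    [FiniteDimensional ℝ E] {s : Set E} {z w : E} (hz : z ∈ s) (hw : w ∉ s) :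
    Metric.infDist z (frontier s) ≤ dist z w := by
  obtain ⟨q, hq, h⟩ := exists_mem_frontier_infDist_compl_eq_dist hz
    (ne_univ_iff_exists_notMem s |>.2 ⟨w, hw⟩)
  exact (Metric.infDist_le_dist_of_mem hq).trans (h ▸ Metric.infDist_le_dist_of_mem hw)

/-- If a half-space contains `s`, the distance from a point of `s` to the boundary of `s` is at most
its distance to the hyperplane bounding the half-space. -/
theorem infDist_frontier_le_inner {E : Type*} [NormedAddCommGroup E] [InnerProductSpace ℝ E]
    [FiniteDimensional ℝ E] {s : Set E} {n V z : E} (hn : ‖n‖ = 1)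
    (hs : ∀ w ∈ s, 0 ≤ ⟪n, w - V⟫) (hz : z ∈ s) :
    Metric.infDist z (frontier s) ≤ ⟪n, z - V⟫ := by
  refine le_of_forall_pos_le_add fun ε hε => ?_
  -- The point `ε` beyond the foot of the perpendicular from `z`; the foot itself could lie in `s`.
  set w : E := z - (⟪n, z - V⟫ + ε) • n with hw
  have hws : w ∉ s := fun h => by
    have := hs w h
    rw [hw, sub_right_comm, inner_sub_right, inner_smul_right, real_inner_self_eq_norm_sq, hn]
      at this
    linarith
  refine (infDist_frontier_le_dist hz hws).trans_eq ?_
  rw [dist_eq_norm, hw, sub_sub_cancel, norm_smul, hn, mul_one, Real.norm_eq_abs,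
    abs_of_nonneg (add_nonneg (hs z hz) hε.le)]

/-- The smaller of the distances to two supporting hyperplanes through `V` is at most their average,
which is the inner product of `z - V` with half the sum of the unit normals. -/
theorem infDist_frontier_le_half_norm_add_mul_dist {E : Type*} [NormedAddCommGroup E]
    [InnerProductSpace ℝ E] [FiniteDimensional ℝ E] {s : Set E} {m n V z : E} (hm : ‖m‖ = 1)
    (hn : ‖n‖ = 1) (hms : ∀ w ∈ s, 0 ≤ ⟪m, w - V⟫) (hns : ∀ w ∈ s, 0 ≤ ⟪n, w - V⟫) (hz : z ∈ s) :
    Metric.infDist z (frontier s) ≤ ‖m + n‖ / 2 * dist z V := by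
  have h1 := infDist_frontier_le_inner hm hms hz
  have h2 := infDist_frontier_le_inner hn hns hz
  have h3 := real_inner_le_norm (m + n) (z - V)
  rw [inner_add_left, ← dist_eq_norm z V] at h3
  linarith

/-- Unit normals `m`, `n` to the sides `u`, `v` of an angle, pointing into the angle. They make the
supplementary angle with each other, which gives the norm of their sum. -/
theorem exists_normals {E : Type*} [NormedAddCommGroup E] [InnerProductSpace ℝ E] {u v : E}
    (hu : u ≠ 0) (hv : v ≠ 0) (h : 0 < Real.sin (InnerProductGeometry.angle u v)) :
    ∃ m n : E, ‖m‖ = 1 ∧ ‖n‖ = 1 ∧ ⟪m, u⟫ = 0 ∧ ⟪n, v⟫ = 0 ∧ 0 ≤ ⟪m, v⟫ ∧ 0 ≤ ⟪n, u⟫ ∧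
      ‖m + n‖ / 2 = Real.sin (InnerProductGeometry.angle u v / 2) := by
  wlog hunit : ‖u‖ = 1 ∧ ‖v‖ = 1 generalizing u v
  · have hu' := norm_pos_iff.2 hu
    have hv' := norm_pos_iff.2 hv
    have hang : InnerProductGeometry.angle (‖u‖⁻¹ • u) (‖v‖⁻¹ • v) =
        InnerProductGeometry.angle u v := by
      rw [InnerProductGeometry.angle_smul_left_of_pos _ _ (inv_pos.2 hu'),
        InnerProductGeometry.angle_smul_right_of_pos _ _ (inv_pos.2 hv')]
    obtain ⟨m, n, h1, h2, h3, h4, h5, h6, h7⟩ := this (u := ‖u‖⁻¹ • u) (v := ‖v‖⁻¹ • v)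
      (by simp [hu]) (by simp [hv]) (by rwa [hang]) (by simp [norm_smul, hu, hv])
    rw [inner_smul_right] at h3 h4 h5 h6
    refine ⟨m, n, h1, h2, (mul_eq_zero.1 h3).resolve_left (by simpa),
      (mul_eq_zero.1 h4).resolve_left (by simpa), nonneg_of_mul_nonneg_right h5 (by positivity),
      nonneg_of_mul_nonneg_right h6 (by positivity), by rw [h7, hang]⟩
  obtain ⟨hu1, hv1⟩ := hunit
  set θ := InnerProductGeometry.angle u v with hθ
  have huv : ⟪u, v⟫ = Real.cos θ := by
    simpa [hu1, hv1] using (InnerProductGeometry.cos_angle_mul_norm_mul_norm u v).symm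
  have hvu : ⟪v, u⟫ = Real.cos θ := by rw [real_inner_comm, huv]
  have huu : ⟪u, u⟫ = 1 := by rw [real_inner_self_eq_norm_sq, hu1, one_pow]
  have hvv : ⟪v, v⟫ = 1 := by rw [real_inner_self_eq_norm_sq, hv1, one_pow]
  have hsc := Real.sin_sq_add_cos_sq θ
  have hs0 := h.ne'
  have hsin2 : 0 ≤ Real.sin (θ / 2) := Real.sin_nonneg_of_nonneg_of_le_pi
    (by linarith [InnerProductGeometry.angle_nonneg u v])
    (by linarith [InnerProductGeometry.angle_le_pi u v, Real.pi_pos])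
  have hhalf : (Real.sin (θ / 2) * 2) ^ 2 = 2 * (1 - Real.cos θ) := by
    have h2 := Real.cos_two_mul (θ / 2)
    rw [mul_div_cancel₀ θ two_ne_zero] at h2
    linear_combination 2 * h2 + 4 * Real.sin_sq_add_cos_sq (θ / 2)
  have key : ∀ w : E, ∀ a : ℝ, 0 ≤ a → ‖w‖ ^ 2 = a ^ 2 → ‖w‖ = a := fun w a ha hw =>
    (pow_left_inj₀ (norm_nonneg _) ha two_ne_zero).1 hw
  refine ⟨(Real.sin θ)⁻¹ • (v - Real.cos θ • u), (Real.sin θ)⁻¹ • (u - Real.cos θ • v),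
    key _ _ zero_le_one ?_, key _ _ zero_le_one ?_, ?_, ?_, ?_, ?_, ?_⟩
  case refine_7 =>
    rw [div_eq_iff two_ne_zero]
    refine key _ _ (by positivity) ?_
    rw [← real_inner_self_eq_norm_sq]
    simp only [inner_add_left, inner_add_right, inner_sub_left, inner_sub_right,
      real_inner_smul_left, inner_smul_right, huu, hvv, huv, hvu]
    rw [hhalf]
    field_simp
    linear_combination (-2 + 2 * Real.cos θ) * hsc
  all_goals
    try rw [← real_inner_self_eq_norm_sq]
    simp only [inner_sub_left, inner_sub_right,
      real_inner_smul_left, inner_smul_right, huu, hvv, huv, hvu]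
  · field_simp
    linear_combination -hsc
  · field_simp
    linear_combination -hsc
  · simp
  · simp
  · rw [show 1 - Real.cos θ * Real.cos θ = Real.sin θ ^ 2 by linarith]
    positivity
  · rw [show 1 - Real.cos θ * Real.cos θ = Real.sin θ ^ 2 by linarith]
    positivity

theorem Convex.ball_lineMap_subset_interior {E : Type*} [NormedAddCommGroup E] [NormedSpace ℝ E]
    {K : Set E} (hK : Convex ℝ K) {V c : E} {δ t : ℝ} (hV : V ∈ K) (hc : Metric.ball c δ ⊆ K)
    (ht : t ∈ Ioc (0 : ℝ) 1) :
    Metric.ball (AffineMap.lineMap V c t) (t * δ) ⊆ interior K := by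
  refine interior_maximal (fun z hz => ?_) Metric.isOpen_ball
  -- `z` lies on the segment from `V` to the point `q` of the ball around `c`.
  set q : E := c + t⁻¹ • (z - AffineMap.lineMap V c t) with hq
  have ht0 := ht.1.ne'
  have hqK : q ∈ K := hc <| by
    rw [Metric.mem_ball, dist_eq_norm, hq, add_sub_cancel_left, norm_smul, norm_inv,
      Real.norm_of_nonneg ht.1.le, inv_mul_lt_iff₀ ht.1, ← dist_eq_norm]
    exact hz
  have hzq : z = (1 - t) • V + t • q := by
    rw [hq, smul_add, smul_inv_smul₀ ht0, AffineMap.lineMap_apply_module]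
    abel
  rw [hzq]
  exact hK hV hqK (by linarith [ht.2]) ht.1.le (by ring)

theorem le_infDist_frontier_of_ball_subset {E : Type*} [PseudoMetricSpace E] {s : Set E}
    (hs : IsOpen s) (hf : (frontier s).Nonempty) {x : E} {ρ : ℝ} (h : Metric.ball x ρ ⊆ s) :
    ρ ≤ Metric.infDist x (frontier s) := by
  refine (Metric.le_infDist hf).2 fun q hq => not_lt.1 fun hlt => ?_
  rw [hs.frontier_eq] at hq
  exact hq.2 (h (by rwa [Metric.mem_ball']))

/-! ### Comparison of the two metrics near two boundary points -/

/-- Both logarithms are `log (1 / t) + O(1)` as `t → 0`, so their coefficients can be compared. -/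
theorem le_of_forall_mul_log_le {A B a b : ℝ} (ha : 0 < a) (hb : 0 < b) (hA : 0 ≤ A)
    (h : ∀ t ∈ Ioc (0 : ℝ) (1 / 2), B * Real.log (1 + b / t) ≤ A * Real.log (1 + a / t)) :
    B ≤ A := by
  by_contra! hlt
  -- `1 + a / t ≤ C * (1 + b / t)`, so the logarithms on the two sides of `h` satisfy `hlog` below.
  set C := max 1 (a / b) with hC
  have hC0 : 0 < C := lt_max_of_lt_left one_pos
  have htend : Tendsto (fun t : ℝ => Real.log (1 + b / t)) (𝓝[>] 0) atTop := by
    refine Real.tendsto_log_atTop.comp (tendsto_atTop_add_const_left _ _ ?_)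
    exact (tendsto_inv_nhdsGT_zero.const_mul_atTop hb).congr fun t => (div_eq_mul_inv b t).symm
  obtain ⟨t, ht, htIoc⟩ := ((htend.eventually_gt_atTop (A * Real.log C / (B - A))).and
    (Ioc_mem_nhdsGT (show (0 : ℝ) < 1 / 2 by norm_num))).exists
  have ht0 : 0 < t := htIoc.1
  rw [div_lt_iff₀ (sub_pos.2 hlt)] at ht
  have hle : 1 + a / t ≤ C * (1 + b / t) := by
    have h1 : a ≤ C * b := (div_le_iff₀ hb).1 (le_max_right _ _)
    have h2 : a / t ≤ C * b / t := by gcongr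
    have h3 : 1 ≤ C := le_max_left _ _
    rw [mul_add, mul_one, ← mul_div_assoc]
    exact add_le_add h3 h2
  have hlog : Real.log (1 + a / t) ≤ Real.log C + Real.log (1 + b / t) := by
    rw [← Real.log_mul hC0.ne' (by positivity)]
    exact Real.log_le_log (by positivity) hle
  nlinarith [h t htIoc, mul_le_mul_of_nonneg_left hlog hA]

/-- The uniformity inequality is tested on the points `x`, `y` of the segments from `V` and `W` to a
common interior point `c` at parameter `t`, as `t → 0`. -/
theorem Convex.one_add_inv_le_of_qhDist_le {E : Type*} [NormedAddCommGroup E] [NormedSpace ℝ E]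
    {K : Set E} (hK : Convex ℝ K) {V W : E} {κ A : ℝ} (hVK : V ∈ K) (hWK : W ∈ K) (hVW : V ≠ W)
    (hne : (interior K).Nonempty) (hf : (frontier (interior K)).Nonempty) (hκ : 0 < κ)
    (hV : ∀ z ∈ interior K, Metric.infDist z (frontier (interior K)) ≤ κ * dist z V)
    (hW : ∀ z ∈ interior K, Metric.infDist z (frontier (interior K)) ≤ dist z W)
    (hA : 0 ≤ A) (h : ∀ x ∈ interior K, ∀ y ∈ interior K,
      qhDist (interior K) x y ≤ ENNReal.ofReal (A * distRatio (interior K) x y)) :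
    1 + 1 / κ ≤ A := by
  obtain ⟨c, hc⟩ := hne
  obtain ⟨δ, hδ, hball⟩ := Metric.isOpen_iff.1 isOpen_interior c hc
  have hballK := hball.trans interior_subset
  set R := dist V c + dist W c with hR
  have hD : 0 < dist V W := dist_pos.2 hVW
  have hR0 : 0 < R := hD.trans_le (dist_triangle_right V W c)
  refine le_of_forall_mul_log_le (a := dist V W / δ) (b := dist V W / (4 * R)) (by positivity)
    (by positivity) hA fun t ht => ?_
  have ht0 : 0 < t := ht.1
  have ht1 : t ∈ Ioc (0 : ℝ) 1 := ⟨ht0, ht.2.trans (by norm_num)⟩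
  set x : E := AffineMap.lineMap V c t with hx
  set y : E := AffineMap.lineMap W c t with hy
  have hxb := hK.ball_lineMap_subset_interior hVK hballK ht1
  have hyb := hK.ball_lineMap_subset_interior hWK hballK ht1
  have hxd := le_infDist_frontier_of_ball_subset isOpen_interior hf hxb
  have hyd := le_infDist_frontier_of_ball_subset isOpen_interior hf hyb
  have hxG : x ∈ interior K := hxb (Metric.mem_ball_self (by positivity))
  have hyG : y ∈ interior K := hyb (Metric.mem_ball_self (by positivity))
  have hxy : dist x y = (1 - t) * dist V W := by
    have : x - y = (1 - t) • (V - W) := by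
      rw [hx, hy, AffineMap.lineMap_apply_module, AffineMap.lineMap_apply_module, smul_sub]
      abel
    rw [dist_eq_norm, this, norm_smul, Real.norm_of_nonneg (by linarith [ht1.2]), dist_eq_norm]
  have hxV : dist x V ≤ t * R := by
    rw [hx, dist_lineMap_left, Real.norm_of_nonneg ht0.le]
    gcongr
    exact le_add_of_nonneg_right dist_nonneg
  have hyW : dist y W ≤ t * R := by
    rw [hy, dist_lineMap_left, Real.norm_of_nonneg ht0.le]
    gcongr
    exact le_add_of_nonneg_left dist_nonneg
  have hlow := (ofReal_le_qhDist hκ (by positivity) hV hW hxV hyW).trans (h x hxG y hyG)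
  have hm : t * δ ≤ min (Metric.infDist x (frontier (interior K)))
    (Metric.infDist y (frontier (interior K))) := le_min hxd hyd
  have hm0 : 0 < t * δ := by positivity
  have hj0 : 0 ≤ distRatio (interior K) x y :=
    Real.log_nonneg (le_add_of_nonneg_right (div_nonneg dist_nonneg (hm0.le.trans hm)))
  rw [ENNReal.ofReal_le_ofReal_iff (mul_nonneg hA hj0)] at hlow
  have hj : distRatio (interior K) x y ≤ Real.log (1 + dist V W / δ / t) := by
    have hle : dist x y ≤ dist V W := by
      rw [hxy]
      exact mul_le_of_le_one_left hD.le (by linarith)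
    rw [div_div, mul_comm δ t]
    refine Real.log_le_log ?_ (by gcongr)
    exact add_pos_of_pos_of_nonneg one_pos (div_nonneg dist_nonneg (hm0.le.trans hm))
  have hk : Real.log (1 + dist V W / (4 * R) / t) ≤ Real.log (1 + dist x y / 2 / (t * R)) := by
    have hle : dist V W / 2 ≤ dist x y := by
      rw [hxy]
      nlinarith [ht.2]
    have heq : dist V W / (4 * R) / t = dist V W / 2 / 2 / (t * R) := by
      field_simp
      norm_num
    rw [heq]
    gcongr
  calc _ ≤ (1 + 1 / κ) * Real.log (1 + dist x y / 2 / (t * R)) := by gcongr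
    _ ≤ A * distRatio (interior K) x y := hlow
    _ ≤ _ := by gcongr

/-- Being on the same side of a subspace, expressed by the sign of the inner product with a normal
vector. -/
theorem AffineSubspace.SSameSide.inner_nonneg {E : Type*} [NormedAddCommGroup E]
    [InnerProductSpace ℝ E] {s : AffineSubspace ℝ E} {a b p n : E} (h : s.SSameSide a b)
    (hp : p ∈ s) (hn : ∀ q ∈ s, ⟪n, q - p⟫ = 0) (ha : 0 ≤ ⟪n, a - p⟫) : 0 ≤ ⟪n, b - p⟫ := by
  obtain ⟨has, -, q, hq, hray⟩ := (AffineSubspace.sSameSide_iff_exists_left hp).1 h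
  obtain ⟨r, hr, hrq⟩ := hray.exists_nonneg_left (vsub_ne_zero.2 fun h => has (h ▸ hp))
  rw [vsub_eq_sub, vsub_eq_sub] at hrq
  rw [← sub_add_sub_cancel b q p, inner_add_right, hn q hq, ← hrq, inner_smul_right, add_zero]
  exact mul_nonneg hr ha

theorem inner_sub_eq_zero_of_mem_line {E : Type*} [NormedAddCommGroup E] [InnerProductSpace ℝ E]
    {n p₁ p₂ p q : E} (h₁ : ⟪n, p₁ - p⟫ = 0) (h₂ : ⟪n, p₂ - p⟫ = 0) (hq : q ∈ line[ℝ, p₁, p₂]) :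
    ⟪n, q - p⟫ = 0 := by
  rw [← vsub_vadd q p₁, vadd_left_mem_affineSpan_pair] at hq
  obtain ⟨r, hr⟩ := hq
  rw [vsub_eq_sub, vsub_eq_sub] at hr
  rw [← sub_add_sub_cancel q p₁ p, ← hr, ← sub_sub_sub_cancel_right p₂ p₁ p, inner_add_right,
    inner_smul_right, inner_sub_right, h₁, h₂, sub_zero, mul_zero, add_zero]

/-! ### Convex polygons -/

namespace Polygon

theorem inner_nonneg_of_mem_convexRegion {n : ℕ} {P : Polygon (EuclideanSpace ℝ (Fin 2)) n}
    {m V : EuclideanSpace ℝ (Fin 2)}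
    (h : ∀ i, 0 ≤ ⟪m, P i - V⟫) {z : EuclideanSpace ℝ (Fin 2)} (hz : z ∈ P.convexRegion) :
    0 ≤ ⟪m, z - V⟫ := by
  have hsub : convexHull ℝ (range P.vertices) ⊆ {z | ⟪m, V⟫ ≤ ⟪m, z⟫} := by
    refine convexHull_min ?_ (convex_halfSpace_ge (innerSL ℝ m).isLinear _)
    rintro _ ⟨i, rfl⟩
    simpa [inner_sub_right] using h i
  simpa [inner_sub_right] using hsub (interior_subset hz)

variable {n : ℕ} [NeZero n] {P : Polygon (EuclideanSpace ℝ (Fin 2)) n}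

theorem IsConvex.add_one_ne (hP : P.IsConvex) (i : Fin n) : i + 1 ≠ i := by
  obtain ⟨m, rfl⟩ := Nat.exists_eq_add_of_le' hP.1
  simp

theorem IsConvex.sub_one_ne (hP : P.IsConvex) (i : Fin n) : i - 1 ≠ i := fun h =>
  hP.add_one_ne i (sub_eq_iff_eq_add.1 h).symm

theorem IsConvex.sub_one_ne_add_one (hP : P.IsConvex) (i : Fin n) : i - 1 ≠ i + 1 := by
  obtain ⟨m, rfl⟩ := Nat.exists_eq_add_of_le' hP.1
  rw [Ne, sub_eq_iff_eq_add, add_assoc, left_eq_add, Fin.ext_iff, Fin.val_add]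
  simp [Nat.mod_eq_of_lt (show 2 < m + 3 by lia)]

/-- For a normal `m` to an edge it suffices to test one vertex `k` off the edge: all vertices then
lie in the half-plane `0 ≤ ⟪m, · - p⟫`. -/
theorem IsConvex.inner_nonneg_of_edge (hP : P.IsConvex) {i k : Fin n}
    {m p : EuclideanSpace ℝ (Fin 2)} (hki : k ≠ i) (hki' : k ≠ i + 1)
    (hp : p ∈ line[ℝ, P i, P (i + 1)]) (h₁ : ⟪m, P i - p⟫ = 0) (h₂ : ⟪m, P (i + 1) - p⟫ = 0)
    (hk : 0 ≤ ⟪m, P k - p⟫) (j : Fin n) : 0 ≤ ⟪m, P j - p⟫ := by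
  by_cases hji : j = i
  · rw [hji, h₁]
  by_cases hji' : j = i + 1
  · rw [hji', h₂]
  exact (hP.2 i k j hki hki' hji hji').inner_nonneg hp
    (fun q hq => inner_sub_eq_zero_of_mem_line h₁ h₂ hq) hk

theorem IsConvex.affineIndependent (hP : P.IsConvex) (i : Fin n) :
    AffineIndependent ℝ ![P (i - 1), P i, P (i + 1)] := by
  have h1 := hP.2 (i - 1) (i + 1) (i + 1) (hP.sub_one_ne_add_one i).symm
    (by simpa using hP.add_one_ne i) (hP.sub_one_ne_add_one i).symm
    (by simpa using hP.add_one_ne i)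
  have h2 := hP.2 i (i - 1) (i - 1) (hP.sub_one_ne i) (hP.sub_one_ne_add_one i)
    (hP.sub_one_ne i) (hP.sub_one_ne_add_one i)
  rw [sub_add_cancel] at h1
  have hne : P (i - 1) ≠ P i := fun h => h2.2.1 (h ▸ left_mem_affineSpan_pair ℝ _ _)
  exact affineIndependent_of_ne_of_mem_of_mem_of_notMem hne (left_mem_affineSpan_pair ℝ _ _)
    (right_mem_affineSpan_pair ℝ _ _) h1.2.1

theorem IsConvex.nonempty_convexRegion (hP : P.IsConvex) : P.convexRegion.Nonempty := by
  rw [convexRegion, interior_convexHull_nonempty_iff_affineSpan_eq_top, eq_top_iff]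
  rw [← ((hP.affineIndependent 0).affineSpan_eq_top_iff_card_eq_finrank_add_one).2 (by simp)]
  refine affineSpan_mono ℝ ?_
  rintro _ ⟨k, rfl⟩
  fin_cases k <;> exact mem_range_self _

end Polygon

theorem theorem1p8 {n : ℕ} [NeZero n] (P : Polygon (EuclideanSpace ℝ (Fin 2)) n)
    (hP : P.IsConvex) (α : ℝ) (hα : IsLeast (Set.range P.innerAngle) α) :
    ((1 + 1 / Real.sin (α / 2) : ℝ) : EReal) ≤ uniformityConst P.convexRegion := by
  obtain ⟨⟨i, rfl⟩, -⟩ := hα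
  refine le_iInf₂ fun A hA => EReal.coe_le_coe_iff.2 ?_
  have hind := hP.affineIndependent i
  have hsin : 0 < Real.sin (P.innerAngle i) :=
    EuclideanGeometry.sin_pos_of_not_collinear (affineIndependent_iff_not_collinear_set.1 hind)
  have hVW : P i ≠ P (i + 1) := hind.injective.ne (show (1 : Fin 3) ≠ 2 by decide)
  have hUV : P (i - 1) ≠ P i := hind.injective.ne (show (0 : Fin 3) ≠ 1 by decide)
  have hκ : 0 < Real.sin (P.innerAngle i / 2) := by
    have h0 : 0 ≤ P.innerAngle i := EuclideanGeometry.angle_nonneg _ _ _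
    have hpi : P.innerAngle i ≤ Real.pi := EuclideanGeometry.angle_le_pi _ _ _
    have hpos : 0 < P.innerAngle i := h0.lt_of_ne fun h => by simp [← h] at hsin
    exact Real.sin_pos_of_pos_of_lt_pi (half_pos hpos) (by linarith)
  obtain ⟨m, m', hm, hm', hmu, hmv, hmv', hmu', hsum⟩ := exists_normals
    (vsub_ne_zero.2 hUV) (vsub_ne_zero.2 hVW.symm) hsin
  rw [vsub_eq_sub, vsub_eq_sub] at *
  have hmP : ∀ z ∈ P.convexRegion, 0 ≤ ⟪m, z - P i⟫ := fun z => by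
    refine Polygon.inner_nonneg_of_mem_convexRegion
      (hP.inner_nonneg_of_edge (i := i - 1) (k := i + 1) (hP.sub_one_ne_add_one i).symm
      (by simpa using hP.add_one_ne i) ?_ hmu ?_ hmv')
    · simpa using right_mem_affineSpan_pair ℝ (P (i - 1)) (P i)
    · simp
  have hmP' : ∀ z ∈ P.convexRegion, 0 ≤ ⟪m', z - P i⟫ := fun z =>
    Polygon.inner_nonneg_of_mem_convexRegion
      (hP.inner_nonneg_of_edge (hP.sub_one_ne i) (hP.sub_one_ne_add_one i)
      (left_mem_affineSpan_pair ℝ _ _) (by simp) hmv hmu')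
  have hW : ∀ z ∈ P.convexRegion, Metric.infDist z (frontier P.convexRegion) ≤
      dist z (P (i + 1)) := fun z hz => by
    refine (infDist_frontier_le_inner (V := P (i + 1)) hm' (fun w hw => ?_) hz).trans ?_
    · have := hmP' w hw
      rwa [← sub_add_sub_cancel w (P (i + 1)) (P i), inner_add_right, hmv, add_zero] at this
    · simpa [hm', dist_eq_norm] using real_inner_le_norm m' (z - P (i + 1))
  have hf : (frontier P.convexRegion).Nonempty := by
    obtain ⟨z, hz⟩ := hP.nonempty_convexRegion
    -- `infDist` to the empty set is `0`, so the boundary must be seen to be nonempty.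
    have hne : P.convexRegion ≠ univ := fun h => by
      have := hmP (P i - m) (h ▸ mem_univ _)
      rw [sub_sub_cancel_left, inner_neg_right, real_inner_self_eq_norm_sq, hm] at this
      norm_num at this
    exact (exists_mem_frontier_infDist_compl_eq_dist hz hne).imp fun _ h => h.1
  refine (convex_convexHull ℝ (range P.vertices)).one_add_inv_le_of_qhDist_le
    (subset_convexHull ℝ _ (mem_range_self i)) (subset_convexHull ℝ _ (mem_range_self (i + 1)))
    hVW hP.nonempty_convexRegion hf hκ (fun z hz => ?_) hW (zero_le_one.trans hA.1) hA.2
  exact (infDist_frontier_le_half_norm_add_mul_dist hm hm' hmP hmP' hz).trans_eq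
    (by rw [hsum]; rfl)
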